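/- **Theorem.** An *inverse monoid* is a monoid with an involution $x\mapsto x^{-1}$ (so $(x^{-1})^{-1}=x$, $(xy)^{-1}=y^{-1}x^{-1}$) satisfying $xx^{-1}x=x$ and $xx^{-1}yy^{-1}=yy^{-1}xx^{-1}$; put $x^{\circledast}=x^{-1}x$ and $x^{\oplus}=xx^{-1}$. Let $S$ be an inverse monoid. Let $S^{pr}$ be the Lawson–Margolis–Steinberg generalized prefix expansion of $S$: the inverse monoid of all pairs $(A,s)$, where $s\in S$ and $A\subseteq S$ is a finite set with $ss^{-1},s\in A$ and $aa^{-1}=ss^{-1}$ for all $a\in A$, with $$(A,s)(B,t)=\bigl((st)(st)^{-1}A\cup sB,\ st\bigr),\qquad (A,s)^{-1}=(s^{-1}A,\,s^{-1}),\qquad 1=(\{1\},1).$$ Let $\mathcal{FI}_s(S)$ be the free inverse monoid over $S$ with respect to strong premorphisms, that is, the inverse monoid generated by the symbols $[s]$, $s\in S$, subject to the defining relations $$[1]=1,\qquad [s][t]=[st][t]^{\circledast},\qquad [s][t]=[s]^{\oplus}[st]\qquad (s,t\in S).\tag{$*$}$$ Then there is an isomorphism of inverse monoids $S^{pr}\to\mathcal{FI}_s(S)$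 which maps $(\{ss^{-1},s\},s)$ to $[s]$ for every $s\in S$. In particular, $S^{pr}$ is presented, as an inverse monoid, by the generators $[s]=(\{ss^{-1},s\},s)$, $s\in S$, subject to the defining relations $(*)$: the canonical homomorphism from the free inverse monoid over the set $\{[s]:s\in S\}$ to $S^{pr}$ is onto, and its kernel is the congruence generated by $(*)$. -/

import Mathlib

universe u v

/-- Inverse monoids, as algebras `(S; *, ⁻¹, 1)`: the inversion is an involution (an involutive
anti-automorphism) and satisfies `x x⁻¹ x = x` and `x x⁻¹ y y⁻¹ = y y⁻¹ x x⁻¹`. -/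
class InverseMonoid (S : Type u) extends Monoid S, InvolutiveInv S where
  mul_inv_rev' : ∀ x y : S, (x * y)⁻¹ = y⁻¹ * x⁻¹
  mul_inv_mul' : ∀ x : S, x * x⁻¹ * x = x
  mul_inv_comm' : ∀ x y : S, x * x⁻¹ * (y * y⁻¹) = y * y⁻¹ * (x * x⁻¹)

namespace InverseMonoid

/-- `x^⊛ = x⁻¹ x`. -/
def star {S : Type u} [Mul S] [Inv S] (x : S) : S := x⁻¹ * x

/-- `x^⊕ = x x⁻¹`. -/
def plus {S : Type u} [Mul S] [Inv S] (x : S) : S := x * x⁻¹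

/-! ### Elementary identities -/

section Basic

variable {S : Type u} [InverseMonoid S]

theorem mul_inv_rev (x y : S) : (x * y)⁻¹ = y⁻¹ * x⁻¹ := mul_inv_rev' x y

theorem mul_inv_mul (x : S) : x * x⁻¹ * x = x := mul_inv_mul' x

theorem mul_inv_mul_assoc (x y : S) : x * (x⁻¹ * (x * y)) = x * y := by
  rw [← mul_assoc, ← mul_assoc, mul_inv_mul]

theorem inv_mul_inv_assoc (x y : S) : x⁻¹ * (x * (x⁻¹ * y)) = x⁻¹ * y := by
  simpa using mul_inv_mul_assoc x⁻¹ y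

theorem plus_comm (x y : S) : x * x⁻¹ * (y * y⁻¹) = y * y⁻¹ * (x * x⁻¹) := mul_inv_comm' x y

theorem star_plus_comm (x y : S) : x⁻¹ * x * (y * y⁻¹) = y * y⁻¹ * (x⁻¹ * x) := by
  simpa using plus_comm x⁻¹ y

theorem plus_idem (x : S) : x * x⁻¹ * (x * x⁻¹) = x * x⁻¹ := by
  rw [← mul_assoc, mul_inv_mul]

theorem inv_plus (x : S) : (x * x⁻¹)⁻¹ = x * x⁻¹ := by rw [mul_inv_rev, inv_inv]

theorem one_inv : (1 : S)⁻¹ = 1 := by simpa using mul_inv_mul (1 : S)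

/-- `(xy)^⊕ x = x y^⊕`. -/
theorem plus_mul_self (x y : S) : x * y * (x * y)⁻¹ * x = x * (y * y⁻¹) := by
  have h : x * y * (x * y)⁻¹ * x = x * (y * y⁻¹ * (x⁻¹ * x)) := by
    simp only [mul_inv_rev, mul_assoc]
  rw [h, ← star_plus_comm, ← mul_assoc, ← mul_assoc x, mul_inv_mul]

/-- `(xy)^⊕ x^⊕ = (xy)^⊕`. -/
theorem plus_mul_plus (x y : S) : x * y * (x * y)⁻¹ * (x * x⁻¹) = x * y * (x * y)⁻¹ := by
  simp only [mul_inv_rev, mul_assoc]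
  have := inv_mul_inv_assoc x (1 : S)
  rw [mul_one] at this
  rw [this]

end Basic

/-! ### Presentations of inverse monoids -/

/-- The least congruence, compatible with multiplication and inversion, that contains `r`. -/
inductive InvCongr {T : Type u} [Mul T] [Inv T] (r : T → T → Prop) : T → T → Prop
  | of {x y : T} : r x y → InvCongr r x y
  | refl (x : T) : InvCongr r x x
  | symm {x y : T} : InvCongr r x y → InvCongr r y x
  | trans {x y z : T} : InvCongr r x y → InvCongr r y z → InvCongr r x z
  | mul {x y z w : T} : InvCongr r x y → InvCongr r z w → InvCongr r (x * z) (y * w)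
  | inv {x y : T} : InvCongr r x y → InvCongr r x⁻¹ y⁻¹

/-- The setoid of `InvCongr r`. -/
def invSetoid {T : Type u} [Mul T] [Inv T] (r : T → T → Prop) : Setoid T where
  r := InvCongr r
  iseqv := ⟨InvCongr.refl, InvCongr.symm, InvCongr.trans⟩

/-- A relation satisfied in the target of a map preserving `*` and `⁻¹` passes to the generated
congruence. -/
theorem InvCongr.map_eq {T : Type u} {U : Type v} [Mul T] [Inv T] [Mul U] [Inv U]
    {r : T → T → Prop} (f : T → U) (hmul : ∀ x y, f (x * y) = f x * f y)
    (hinv : ∀ x, f x⁻¹ = (f x)⁻¹) (hr : ∀ x y, r x y → f x = f y) {x y : T}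
    (h : InvCongr r x y) : f x = f y := by
  induction h with
  | of h => exact hr _ _ h
  | refl => rfl
  | symm _ ih => exact ih.symm
  | trans _ _ ih1 ih2 => exact ih1.trans ih2
  | mul _ _ ih1 ih2 => rw [hmul, hmul, ih1, ih2]
  | inv _ ih => rw [hinv, hinv, ih]

/-- The free monoid with involution on `X`: words over `X ⊔ X⁻¹`, where the letter `(x, true)`
stands for `x` and `(x, false)` for `x⁻¹`. -/
def Word (X : Type u) : Type u := FreeMonoid (X × Bool)

namespace Word

variable {X : Type u}

instance : Monoid (Word X) := inferInstanceAs (Monoid (FreeMonoid (X × Bool)))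

/-- Reverse the word and invert each letter. -/
instance : InvolutiveInv (Word X) where
  inv w := FreeMonoid.ofList (FreeGroup.invRev (FreeMonoid.toList w))
  inv_inv w := FreeGroup.invRev_invRev (L₁ := FreeMonoid.toList w)

theorem mul_inv_rev (x y : Word X) : (x * y)⁻¹ = y⁻¹ * x⁻¹ :=
  FreeGroup.invRev_append (L₁ := FreeMonoid.toList x) (L₂ := FreeMonoid.toList y)

/-- The one-letter word `x`. -/
def of (x : X) : Word X := FreeMonoid.of (x, true)

/-- Evaluation of words in an inverse monoid. -/
def eval {T : Type v} [InverseMonoid T] (f : X → T) : Word X →* T :=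
  FreeMonoid.lift (fun p : X × Bool => cond p.2 (f p.1) (f p.1)⁻¹)

theorem eval_of {T : Type v} [InverseMonoid T] (f : X → T) (x : X) : eval f (of x) = f x :=
  FreeMonoid.lift_eval_of _ _

theorem eval_inv {T : Type v} [InverseMonoid T] (f : X → T) (w : Word X) :
    eval f w⁻¹ = (eval f w)⁻¹ := by
  have hletter : ∀ (x : X) (b : Bool),
      eval f (FreeMonoid.of (x, b) : Word X) = cond b (f x) (f x)⁻¹ :=
    fun x b => FreeMonoid.lift_eval_of _ _
  have hl : ∀ p : X × Bool, eval f (FreeMonoid.of p : Word X)⁻¹ =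
      (eval f (FreeMonoid.of p : Word X))⁻¹ := by
    rintro ⟨x, b⟩
    refine (hletter x !b).trans ?_
    rw [hletter x b]
    cases b
    · exact (inv_inv _).symm
    · rfl
  have hw : ∀ l : List (X × Bool), eval f ((FreeMonoid.ofList l : Word X)⁻¹) =
      (eval f (FreeMonoid.ofList l : Word X))⁻¹ := by
    intro l
    induction l with
    | nil =>
      change eval f (1 : Word X) = (eval f (1 : Word X))⁻¹
      rw [map_one, one_inv]
    | cons p l ih =>
      have key : ∀ u v : Word X, eval f u⁻¹ = (eval f u)⁻¹ → eval f v⁻¹ = (eval f v)⁻¹ →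
          eval f (u * v)⁻¹ = (eval f (u * v))⁻¹ := by
        intro u v hu hv
        rw [mul_inv_rev, map_mul, map_mul, hu, hv, InverseMonoid.mul_inv_rev]
      exact key _ _ (hl p) ih
  exact hw w

end Word

/-- The relations `w w⁻¹ w = w` and `v v⁻¹ w w⁻¹ = w w⁻¹ v v⁻¹` defining the free inverse
monoid. -/
inductive WagnerRel {X : Type u} : Word X → Word X → Prop
  | regular (w : Word X) : WagnerRel (w * w⁻¹ * w) w
  | comm (v w : Word X) : WagnerRel (v * v⁻¹ * (w * w⁻¹)) (w * w⁻¹ * (v * v⁻¹))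

/-- The free inverse monoid over the set `X`. -/
def Free (X : Type u) : Type u := Quotient (invSetoid (WagnerRel (X := X)))

namespace Free

variable {X : Type u}

instance : InverseMonoid (Free X) where
  mul := Quotient.map₂ (· * ·) (fun _ _ h _ _ h' => InvCongr.mul h h')
  one := Quotient.mk _ 1
  inv := Quotient.map (·⁻¹) (fun _ _ h => InvCongr.inv h)
  mul_assoc := by
    rintro ⟨a⟩ ⟨b⟩ ⟨c⟩; exact congrArg (Quotient.mk _) (mul_assoc a b c)
  one_mul := by rintro ⟨a⟩; exact congrArg (Quotient.mk _) (one_mul a)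
  mul_one := by rintro ⟨a⟩; exact congrArg (Quotient.mk _) (mul_one a)
  inv_inv := by rintro ⟨a⟩; exact congrArg (Quotient.mk _) (inv_inv a)
  mul_inv_rev' := by
    rintro ⟨a⟩ ⟨b⟩; exact congrArg (Quotient.mk _) (Word.mul_inv_rev a b)
  mul_inv_mul' := by rintro ⟨a⟩; exact Quotient.sound (InvCongr.of (WagnerRel.regular a))
  mul_inv_comm' := by
    rintro ⟨a⟩ ⟨b⟩; exact Quotient.sound (InvCongr.of (WagnerRel.comm a b))

/-- The generator of `Free X` given by `x`. -/
def of (x : X) : Free X := Quotient.mk _ (Word.of x)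

/-- The homomorphism from the free inverse monoid extending a map of the generators. -/
def lift {T : Type v} [InverseMonoid T] (f : X → T) : Free X →* T where
  toFun := Quotient.lift (Word.eval f) (fun _ _ h =>
    InvCongr.map_eq (Word.eval f) (map_mul _) (Word.eval_inv f)
      (by
        rintro _ _ (w | ⟨v, w⟩)
        · simp only [map_mul, Word.eval_inv, mul_inv_mul]
        · simp only [map_mul, Word.eval_inv]
          exact plus_comm _ _) h)
  map_one' := map_one (Word.eval f)
  map_mul' := by rintro ⟨a⟩ ⟨b⟩; exact map_mul (Word.eval f) a b

theorem lift_of {T : Type v} [InverseMonoid T] (f : X → T) (x : X) : lift f (of x) = f x :=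
  Word.eval_of f x

theorem lift_inv {T : Type v} [InverseMonoid T] (f : X → T) (w : Free X) :
    lift f w⁻¹ = (lift f w)⁻¹ := by
  obtain ⟨w⟩ := w
  exact Word.eval_inv f w

end Free

/-- The inverse monoid generated by `X` subject to the defining relations `r`. -/
def Presented {X : Type u} (r : Free X → Free X → Prop) : Type u := Quotient (invSetoid r)

namespace Presented

variable {X : Type u} {r : Free X → Free X → Prop}

instance : InverseMonoid (Presented r) where
  mul := Quotient.map₂ (· * ·) (fun _ _ h _ _ h' => InvCongr.mul h h')
  one := Quotient.mk _ 1
  inv := Quotient.map (·⁻¹) (fun _ _ h => InvCongr.inv h)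
  mul_assoc := by
    rintro ⟨a⟩ ⟨b⟩ ⟨c⟩; exact congrArg (Quotient.mk _) (mul_assoc a b c)
  one_mul := by rintro ⟨a⟩; exact congrArg (Quotient.mk _) (one_mul a)
  mul_one := by rintro ⟨a⟩; exact congrArg (Quotient.mk _) (mul_one a)
  inv_inv := by rintro ⟨a⟩; exact congrArg (Quotient.mk _) (inv_inv a)
  mul_inv_rev' := by
    rintro ⟨a⟩ ⟨b⟩; exact congrArg (Quotient.mk _) (mul_inv_rev a b)
  mul_inv_mul' := by rintro ⟨a⟩; exact congrArg (Quotient.mk _) (mul_inv_mul a)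
  mul_inv_comm' := by
    rintro ⟨a⟩ ⟨b⟩; exact congrArg (Quotient.mk _) (plus_comm a b)

/-- The generator of `Presented r` given by `x`. -/
def of (x : X) : Presented r := Quotient.mk _ (Free.of x)

end Presented

/-- `T` is generated, as an inverse monoid, by the elements `g x`, `x ∈ X`, subject to the defining
relations `r`: the canonical homomorphism from the free inverse monoid over `X` is onto, and
it identifies exactly the pairs in the congruence generated by `r`. -/
def IsPresentedBy {X : Type u} {T : Type v} [InverseMonoid T] (g : X → T)
    (r : Free X → Free X → Prop) : Prop :=
  Function.Surjective (Free.lift g) ∧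
    ∀ x y : Free X, Free.lift g x = Free.lift g y ↔ InvCongr r x y

/-- The relations `[1] = 1`, `[m][n] = [mn][n]^⊛` and `[m][n] = [m]^⊕[mn]`, which say that
`m ↦ [m]` is a strong premorphism. -/
inductive StrongRel (M : Type u) [Monoid M] : Free M → Free M → Prop
  | one : StrongRel M (Free.of 1) 1
  | right (m n : M) :
      StrongRel M (Free.of m * Free.of n) (Free.of (m * n) * star (Free.of n))
  | left (m n : M) :
      StrongRel M (Free.of m * Free.of n) (plus (Free.of m) * Free.of (m * n))

/-- `FI_s(M)`, the free inverse monoid over the monoid `M` with respect to strong premorphisms. -/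
abbrev FIs (M : Type u) [Monoid M] : Type u := Presented (StrongRel M)

/-! ### The generalized prefix expansion -/

/-- The Lawson-Margolis-Steinberg generalized prefix expansion of an inverse monoid `S`: pairs
`(A, s)` where `s ∈ S` and `A` is a finite subset of the `𝓡`-class of `s`
(that is, `a a⁻¹ = s s⁻¹` for `a ∈ A`) containing `s s⁻¹` and `s`. -/
@[ext]
structure PrefixExpansion (S : Type u) [InverseMonoid S] where
  carrier : Set S
  val : S
  finite : carrier.Finite
  rclass : ∀ a ∈ carrier, a * a⁻¹ = val * val⁻¹
  plus_mem : val * val⁻¹ ∈ carrier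
  val_mem : val ∈ carrier

namespace PrefixExpansion

variable {S : Type u} [InverseMonoid S]

/-- `(A, s)(B, t) = ((st)(st)⁻¹A ∪ sB, st)`. -/
instance : Mul (PrefixExpansion S) where
  mul p q :=
    { carrier := (fun a => p.val * q.val * (p.val * q.val)⁻¹ * a) '' p.carrier ∪
        (fun b => p.val * b) '' q.carrier
      val := p.val * q.val
      finite := (p.finite.image _).union (q.finite.image _)
      rclass := by
        rintro _ (⟨a, ha, rfl⟩ | ⟨b, hb, rfl⟩)
        · have h1 := p.rclass a ha
          have h2 : p.val * q.val * (p.val * q.val)⁻¹ * a *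
              (p.val * q.val * (p.val * q.val)⁻¹ * a)⁻¹ =
              p.val * q.val * (p.val * q.val)⁻¹ * (a * a⁻¹) *
                (p.val * q.val * (p.val * q.val)⁻¹) := by
            rw [mul_inv_rev (_ * _) a, inv_plus]; simp only [mul_assoc]
          change _ * a * (_ * a)⁻¹ = _
          rw [h2, h1, plus_mul_plus, plus_idem]
        · have h1 := q.rclass b hb
          have h2 : p.val * b * (p.val * b)⁻¹ = p.val * (b * b⁻¹) * p.val⁻¹ := by
            simp only [mul_inv_rev, mul_assoc]
          change p.val * b * (p.val * b)⁻¹ = _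
          rw [h2, h1]; simp only [mul_inv_rev, mul_assoc]
      plus_mem := Or.inl ⟨_, p.plus_mem, plus_mul_plus _ _⟩
      val_mem := Or.inr ⟨_, q.val_mem, rfl⟩ }

/-- `(A, s)⁻¹ = (s⁻¹A, s⁻¹)`. -/
instance : Inv (PrefixExpansion S) where
  inv p :=
    { carrier := (fun a => p.val⁻¹ * a) '' p.carrier
      val := p.val⁻¹
      finite := p.finite.image _
      rclass := by
        rintro _ ⟨a, ha, rfl⟩
        have h1 := p.rclass a ha
        have h2 : p.val⁻¹ * a * (p.val⁻¹ * a)⁻¹ = p.val⁻¹ * (a * a⁻¹) * p.val := by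
          simp only [mul_inv_rev, inv_inv, mul_assoc]
        change p.val⁻¹ * a * (p.val⁻¹ * a)⁻¹ = _
        rw [h2, h1, inv_inv, mul_assoc, mul_inv_mul]
      plus_mem := ⟨_, p.val_mem, by simp only [inv_inv]⟩
      val_mem := ⟨_, p.plus_mem, by
        have := inv_mul_inv_assoc p.val (1 : S)
        simpa only [mul_one] using this⟩ }

/-- The identity `({1}, 1)`. -/
instance : One (PrefixExpansion S) where
  one :=
    { carrier := {1}
      val := 1
      finite := Set.finite_singleton 1
      rclass := by rintro a rfl; rfl
      plus_mem := by rw [one_inv, one_mul]; rfl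
      val_mem := rfl }

theorem mul_val (p q : PrefixExpansion S) : (p * q).val = p.val * q.val := rfl

theorem mul_carrier (p q : PrefixExpansion S) : (p * q).carrier =
    (fun a => p.val * q.val * (p.val * q.val)⁻¹ * a) '' p.carrier ∪
      (fun b => p.val * b) '' q.carrier := rfl

theorem inv_val (p : PrefixExpansion S) : (p⁻¹).val = p.val⁻¹ := rfl

theorem inv_carrier (p : PrefixExpansion S) :
    (p⁻¹).carrier = (fun a => p.val⁻¹ * a) '' p.carrier := rfl

theorem one_val : (1 : PrefixExpansion S).val = 1 := rfl

theorem one_carrier : (1 : PrefixExpansion S).carrier = {1} := rfl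

/-- `s s⁻¹` acts identically on `A`. -/
theorem plus_mul_mem (p : PrefixExpansion S) {a : S} (ha : a ∈ p.carrier) :
    p.val * p.val⁻¹ * a = a := by
  rw [← p.rclass a ha, mul_inv_mul]

theorem plus_image (p : PrefixExpansion S) :
    (fun a => p.val * p.val⁻¹ * a) '' p.carrier = p.carrier := by
  rw [Set.image_congr (fun a ha => p.plus_mul_mem ha), Set.image_id']

theorem mul_inv_self_val (p : PrefixExpansion S) : (p * p⁻¹).val = p.val * p.val⁻¹ := rfl

theorem mul_inv_self_carrier (p : PrefixExpansion S) : (p * p⁻¹).carrier = p.carrier := by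
  rw [mul_carrier, inv_val, inv_carrier, inv_plus, plus_idem, plus_image, Set.image_image]
  simp only [← mul_assoc]
  rw [plus_image, Set.union_self]

instance : InverseMonoid (PrefixExpansion S) where
  mul_assoc p q r := by
    ext1
    · simp only [mul_carrier, mul_val, Set.image_union, Set.image_image, Set.union_assoc]
      congr 1
      · refine Set.image_congr fun a _ => ?_
        have h := plus_mul_plus (p.val * q.val) r.val
        rw [← mul_assoc, ← mul_assoc] at h
        have h' : ∀ x : S, p.val * q.val * r.val * (p.val * q.val * r.val)⁻¹ * x =
            p.val * q.val * r.val * (p.val * q.val * r.val)⁻¹ *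
              (p.val * q.val * (p.val * q.val)⁻¹ * x) := by
          intro x
          rw [← mul_assoc, plus_mul_plus]
        rw [← h', mul_assoc p.val]
      · congr 1
        · refine Set.image_congr fun b _ => ?_
          have h := plus_mul_self p.val (q.val * r.val)
          rw [← mul_assoc, mul_assoc p.val q.val, h, mul_assoc]
        · exact Set.image_congr fun c _ => mul_assoc _ _ _
    · exact mul_assoc _ _ _
  one_mul p := by
    ext1
    · simp only [mul_carrier, one_val, one_carrier, one_mul, Set.image_id', Set.image_singleton,
        mul_one]
      exact Set.union_eq_self_of_subset_left (Set.singleton_subset_iff.2 p.plus_mem)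
    · exact one_mul _
  mul_one p := by
    ext1
    · simp only [mul_carrier, one_val, one_carrier, mul_one, Set.image_singleton, plus_image]
      exact Set.union_eq_self_of_subset_right (Set.singleton_subset_iff.2 p.val_mem)
    · exact mul_one _
  inv_inv p := by
    ext1
    · simp only [inv_carrier, inv_val, inv_inv, Set.image_image, ← mul_assoc]
      exact plus_image p
    · exact inv_inv _
  mul_inv_rev' p q := by
    ext1
    · simp only [inv_carrier, inv_val, mul_carrier, mul_val, Set.image_union, Set.image_image]
      rw [Set.union_comm]
      have hL : ∀ x : S, (p.val * q.val)⁻¹ * (p.val * x) =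
          q.val⁻¹ * p.val⁻¹ * (q.val⁻¹ * p.val⁻¹)⁻¹ * (q.val⁻¹ * x) := by
        intro x
        have h := plus_mul_self q.val⁻¹ p.val⁻¹
        rw [← mul_assoc _ q.val⁻¹ x, h, mul_inv_rev, inv_inv]
        simp only [mul_assoc]
      have hR : ∀ x : S, (p.val * q.val)⁻¹ * (p.val * q.val * (p.val * q.val)⁻¹ * x) =
          q.val⁻¹ * (p.val⁻¹ * x) := by
        intro x
        have h := inv_mul_inv_assoc (p.val * q.val) x
        rw [mul_assoc (p.val * q.val), h, mul_inv_rev, mul_assoc]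
      simp only [hL, hR]
    · exact mul_inv_rev _ _
  mul_inv_mul' p := by
    ext1
    · rw [mul_carrier, mul_inv_self_carrier, mul_inv_self_val, mul_inv_mul]
      rw [plus_image, Set.union_self]
    · exact mul_inv_mul _
  mul_inv_comm' p q := by
    ext1
    · rw [mul_carrier (p * p⁻¹), mul_carrier (q * q⁻¹), mul_inv_self_carrier,
        mul_inv_self_carrier,
        mul_inv_self_val, mul_inv_self_val]
      have key : ∀ a b : S, ∀ x : S, a * a⁻¹ * x = x →
          a * a⁻¹ * (b * b⁻¹) * (a * a⁻¹ * (b * b⁻¹))⁻¹ * x = b * b⁻¹ * x := by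
        intro a b x hx
        rw [mul_inv_rev, inv_plus, inv_plus, plus_comm b a, mul_assoc (a * a⁻¹) (b * b⁻¹),
          ← mul_assoc (b * b⁻¹) (a * a⁻¹), plus_comm b a, mul_assoc (a * a⁻¹) (b * b⁻¹),
          plus_idem, ← mul_assoc (a * a⁻¹), plus_idem, plus_comm a b, mul_assoc, hx]
      rw [Set.image_congr fun x hx => key p.val q.val x (p.plus_mul_mem hx),
        Set.image_congr (s := q.carrier) fun x hx => key q.val p.val x (q.plus_mul_mem hx)]
      exact Set.union_comm _ _
    · exact plus_comm _ _

/-- The canonical map `S → S^pr`, `s ↦ ({s s⁻¹, s}, s)`. -/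
def of (s : S) : PrefixExpansion S where
  carrier := {s * s⁻¹, s}
  val := s
  finite := Set.toFinite _
  rclass := by
    rintro a (rfl | rfl)
    · rw [inv_plus, plus_idem]
    · rfl
  plus_mem := Or.inl rfl
  val_mem := Or.inr rfl

end PrefixExpansion

end InverseMonoid

/-! Both monoids are universal for strong premorphisms `θ : S → T`. For `FIs S` this is built into
the presentation. For `S^pr`, the extension of `θ` sends `(A, s)` to `∏_{a ∈ A} (θ a)^⊕ · θ s`. The
product ignores order and repetition because its factors are commuting idempotents. Multiplicativity
(`lift`) rests on two rules. By `mul_plusProd`, moving a product over `B` leftwards past `θ s` turns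
it into the product over `sB`. By `plusProd_map_idem_mul`, in front of `θ (st)` the product over
`(st)^⊕A` equals the product over `A`. Conversely, `of` is itself a strong premorphism
(`isStrongPremorphism_of`), and every `(A, s)` equals `∏_{a ∈ A} (of a)^⊕ · of s`
(`lift_isStrongPremorphism_of`). The two induced homomorphisms are therefore mutually inverse, and
the presentation transfers along the isomorphism. -/

namespace InverseMonoid

/-! ### Idempotents and uniqueness of inverses. -/

section InverseMonoidLemmas

variable {T : Type u} [InverseMonoid T]

/-- The axioms only make elements of the form `x x⁻¹` commute; this extends that to all idempotents.
-/
theorem plus_eq_self_of_idem {f : T} (hf : f * f = f) : f * f⁻¹ = f := by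
  have h1 : f⁻¹ = f * f⁻¹ * (f⁻¹ * f) := by
    calc f⁻¹ = f⁻¹ * f * f⁻¹ := by simpa using (mul_inv_mul f⁻¹).symm
      _ = f⁻¹ * (f * f) * f⁻¹ := by rw [hf]
      _ = f⁻¹ * f * (f * f⁻¹) := by simp only [mul_assoc]
      _ = _ := star_plus_comm f f
  have h2 : f * f⁻¹ = f⁻¹ := by
    calc f * f⁻¹ = f * (f * f⁻¹ * (f⁻¹ * f)) := congrArg (f * ·) h1
      _ = f * f * f⁻¹ * (f⁻¹ * f) := by simp only [mul_assoc]
      _ = f⁻¹ := by rw [hf, ← h1]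
  calc f * f⁻¹ = (f * f⁻¹)⁻¹ := (inv_plus f).symm
    _ = f := by rw [h2, inv_inv]

theorem eq_inv_of_mul_mul {x y : T} (hx : x * y * x = x) (hy : y * x * y = y) : y = x⁻¹ := by
  have e1 : x * y * (x * y)⁻¹ = x * y :=
    plus_eq_self_of_idem (by rw [← mul_assoc, hx])
  have e2 : y * x * (y * x)⁻¹ = y * x :=
    plus_eq_self_of_idem (by rw [← mul_assoc, hy])
  have c1 : x * x⁻¹ * (x * y) = x * y * (x * x⁻¹) := by
    simpa only [e1] using plus_comm x (x * y)
  have c2 : x⁻¹ * x * (y * x) = y * x * (x⁻¹ * x) := by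
    simpa only [e2] using star_plus_comm x (y * x)
  calc y = y * (x * y) := by rw [← mul_assoc, hy]
    _ = y * (x * x⁻¹ * (x * y)) := by rw [← mul_assoc (x * x⁻¹), mul_inv_mul]
    _ = y * x * y * (x * x⁻¹) := by rw [c1]; simp only [mul_assoc]
    _ = y * x * x⁻¹ := by rw [hy, mul_assoc]
    _ = y * x * (x⁻¹ * x) * x⁻¹ := by
      have h := inv_mul_inv_assoc x (1 : T)
      rw [mul_one] at h
      simp only [mul_assoc, h]
    _ = x⁻¹ * (x * y * x) * x⁻¹ := by rw [← c2]; simp only [mul_assoc]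
    _ = x⁻¹ := by rw [hx]; simpa using mul_inv_mul x⁻¹

/-- Inverses are determined by multiplication alone, so `→*` and `≃*` are already the right notions
of morphism. -/
theorem map_inv_of_mul {U : Type v} [InverseMonoid U] (f : T →* U) (x : T) :
    f x⁻¹ = (f x)⁻¹ := by
  refine eq_inv_of_mul_mul ?_ ?_
  · rw [← map_mul, ← map_mul, mul_inv_mul]
  · rw [← map_mul, ← map_mul]
    simpa using congrArg f (mul_inv_mul x⁻¹)

theorem plus_left_comm (x y z : T) :
    x * x⁻¹ * (y * y⁻¹ * z) = y * y⁻¹ * (x * x⁻¹ * z) := by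
  rw [← mul_assoc, plus_comm, mul_assoc]

theorem plus_of_plus_mul (x y : T) :
    x * x⁻¹ * y * (x * x⁻¹ * y)⁻¹ = x * x⁻¹ * (y * y⁻¹) := by
  rw [mul_inv_rev, inv_plus, mul_assoc, ← mul_assoc y, plus_comm y x, ← mul_assoc, plus_idem]

end InverseMonoidLemmas

/-! ### Strong premorphisms. -/

/-- A strong premorphism: `θ 1 = 1`, `θ s θ t = θ (st) (θ t)^⊛` and `θ s θ t = (θ s)^⊕ θ (st)`. -/
structure IsStrongPremorphism {S : Type u} {T : Type v} [InverseMonoid S] [InverseMonoid T]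
    (θ : S → T) : Prop where
  map_one : θ 1 = 1
  right : ∀ s t, θ s * θ t = θ (s * t) * ((θ t)⁻¹ * θ t)
  left : ∀ s t, θ s * θ t = θ s * (θ s)⁻¹ * θ (s * t)

namespace IsStrongPremorphism

variable {S : Type u} {T : Type v} [InverseMonoid S] [InverseMonoid T] {θ : S → T}

theorem map_idem (h : IsStrongPremorphism θ) {e : S} (he : e * e = e) : θ e * θ e = θ e := by
  rw [h.left, he, mul_inv_mul]

theorem map_plus_mul (h : IsStrongPremorphism θ) (s : S) : θ (s * s⁻¹) * θ s = θ s := by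
  rw [h.right, mul_inv_mul, ← mul_assoc, mul_inv_mul]

/-- `θ s (θ b)^⊕ = (θ (sb))^⊕ θ s`. -/
theorem mul_plus (h : IsStrongPremorphism θ) (s b : S) :
    θ s * (θ b * (θ b)⁻¹) = θ (s * b) * (θ (s * b))⁻¹ * θ s := by
  -- The left law gives `(θ s θ b)^⊕ = (θ s)^⊕ (θ (sb))^⊕`, and `θ s` absorbs `(θ s)^⊕`.
  rw [← plus_mul_self, h.left, plus_of_plus_mul, plus_comm, mul_assoc, mul_inv_mul]

/-- If `e` is idempotent and `θ e` fixes `x`, then `(θ a)^⊕ x = (θ (ea))^⊕ x`. -/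
theorem plus_mul_of_idem (h : IsStrongPremorphism θ) {e : S} (he : e * e = e) (a : S) {x : T}
    (hx : θ e * x = x) :
    θ (e * a) * (θ (e * a))⁻¹ * x = θ a * (θ a)⁻¹ * x := by
  have hp : θ e * (θ e)⁻¹ = θ e := plus_eq_self_of_idem (h.map_idem he)
  calc θ (e * a) * (θ (e * a))⁻¹ * x = θ (e * a) * (θ (e * a))⁻¹ * θ e * x := by
        rw [mul_assoc _ (θ e), hx]
    _ = θ e * (θ a * (θ a)⁻¹ * x) := by rw [← h.mul_plus, mul_assoc]
    _ = θ e * (θ e)⁻¹ * (θ a * (θ a)⁻¹ * x) := by rw [hp]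
    _ = θ a * (θ a)⁻¹ * x := by rw [plus_left_comm, hp, hx]

end IsStrongPremorphism

/-! ### Finite products of the idempotents `(θ a)^⊕`. -/

/-- The product of the idempotents `(θ a)^⊕`, `a ∈ l`. -/
def plusProd {S : Type u} {T : Type v} [InverseMonoid T] (θ : S → T) (l : List S) : T :=
  (l.map fun a => θ a * (θ a)⁻¹).prod

section PlusProd

variable {S : Type u} {T : Type v} [InverseMonoid T] (θ : S → T)

theorem plusProd_nil : plusProd θ [] = 1 := rfl

theorem plusProd_cons (a : S) (l : List S) :
    plusProd θ (a :: l) = θ a * (θ a)⁻¹ * plusProd θ l := by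
  simp [plusProd]

theorem plusProd_append (l m : List S) :
    plusProd θ (l ++ m) = plusProd θ l * plusProd θ m := by
  simp [plusProd]

theorem plus_mul_plusProd_comm (x : T) (l : List S) :
    x * x⁻¹ * plusProd θ l = plusProd θ l * (x * x⁻¹) := by
  induction l with
  | nil => rw [plusProd_nil, one_mul, mul_one]
  | cons a l ih => rw [plusProd_cons, plus_left_comm, ih, ← mul_assoc]

theorem plusProd_comm (l m : List S) :
    plusProd θ l * plusProd θ m = plusProd θ m * plusProd θ l := by
  induction l with
  | nil => rw [plusProd_nil, one_mul, mul_one]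
  | cons a l ih =>
    rw [plusProd_cons, mul_assoc, ih, ← mul_assoc, plus_mul_plusProd_comm, mul_assoc]

theorem plus_mul_plusProd_of_mem {a : S} {l : List S} (ha : a ∈ l) :
    θ a * (θ a)⁻¹ * plusProd θ l = plusProd θ l := by
  induction l with
  | nil => cases ha
  | cons b l ih =>
    rw [plusProd_cons]
    rcases List.mem_cons.1 ha with rfl | h
    · rw [← mul_assoc, plus_idem]
    · rw [plus_left_comm, ih h]

theorem plusProd_mul_of_subset {l m : List S} (h : l ⊆ m) :
    plusProd θ l * plusProd θ m = plusProd θ m := by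
  induction l with
  | nil => rw [plusProd_nil, one_mul]
  | cons a l ih =>
    rw [plusProd_cons, mul_assoc, ih (List.subset_of_cons_subset h),
      plus_mul_plusProd_of_mem θ (h List.mem_cons_self)]

/-- Each product absorbs the other. Hence the product depends only on the underlying set, and the
listing chosen by `toList` is harmless. -/
theorem plusProd_congr {l m : List S} (h : ∀ x, x ∈ l ↔ x ∈ m) :
    plusProd θ l = plusProd θ m := by
  rw [← plusProd_mul_of_subset θ fun x hx => (h x).2 hx, plusProd_comm,
    plusProd_mul_of_subset θ fun x hx => (h x).1 hx]

variable {θ} [InverseMonoid S]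

theorem IsStrongPremorphism.mul_plusProd (h : IsStrongPremorphism θ) (s : S) (l : List S) :
    θ s * plusProd θ l = plusProd θ (l.map (s * ·)) * θ s := by
  induction l with
  | nil => rw [List.map_nil, plusProd_nil, one_mul, mul_one]
  | cons b l ih =>
    rw [List.map_cons, plusProd_cons, plusProd_cons, ← mul_assoc, h.mul_plus, mul_assoc, ih,
      ← mul_assoc]

theorem IsStrongPremorphism.plusProd_map_idem_mul (h : IsStrongPremorphism θ) {e : S}
    (he : e * e = e) (l : List S) {x : T} (hx : θ e * x = x) :
    plusProd θ (l.map (e * ·)) * x = plusProd θ l * x := by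
  induction l with
  | nil => rfl
  | cons a l ih =>
    have hp : θ e * (θ e)⁻¹ = θ e := plus_eq_self_of_idem (h.map_idem he)
    -- `θ e` is idempotent, so it commutes past the product and still fixes the tail; this lets
    -- `plus_mul_of_idem` apply to the head.
    have hx' : θ e * (plusProd θ l * x) = plusProd θ l * x := by
      rw [← hp, ← mul_assoc, plus_mul_plusProd_comm, mul_assoc, hp, hx]
    rw [List.map_cons, plusProd_cons, plusProd_cons, mul_assoc, ih, h.plus_mul_of_idem he a hx',
      ← mul_assoc]

end PlusProd

/-! ### The universal property of `S^pr`. -/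

namespace PrefixExpansion

variable {S : Type u} [InverseMonoid S]

/-- A list of the elements of the first component. -/
noncomputable def toList (p : PrefixExpansion S) : List S := p.finite.toFinset.toList

theorem mem_toList {p : PrefixExpansion S} {x : S} : x ∈ p.toList ↔ x ∈ p.carrier := by
  simp [toList]

theorem of_val (s : S) : (of s).val = s := rfl

theorem of_carrier (s : S) : (of s).carrier = {s * s⁻¹, s} := rfl

/-- The homomorphism `(A, s) ↦ (∏_{a ∈ A} (θ a)^⊕) θ s` extending a strong premorphism `θ`. -/
noncomputable def lift {T : Type v} [InverseMonoid T] {θ : S → T} (h : IsStrongPremorphism θ) :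
    PrefixExpansion S →* T where
  toFun p := plusProd θ p.toList * θ p.val
  map_one' := by
    have h1 : plusProd θ (1 : PrefixExpansion S).toList = plusProd θ [1] :=
      plusProd_congr θ fun x => by rw [mem_toList, one_carrier]; simp
    rw [h1, one_val, plusProd_cons, plusProd_nil, h.map_one, one_inv]
    simp only [mul_one]
  map_mul' p q := by
    have he := plus_idem (p.val * q.val)
    have h1 : plusProd θ (p * q).toList =
        plusProd θ (q.toList.map (p.val * ·)) *
          plusProd θ (p.toList.map (p.val * q.val * (p.val * q.val)⁻¹ * ·)) := by
      rw [plusProd_comm, ← plusProd_append]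
      refine plusProd_congr θ fun x => ?_
      simp only [mem_toList, mul_carrier, List.mem_append, List.mem_map, Set.mem_union,
        Set.mem_image]
    -- Since `s ∈ A`, the factor `(θ s)^⊕` is available for free, which is what turns `θ (st)` into
    -- `θ s θ t` by the left law.
    have hs : plusProd θ p.toList * (θ p.val * (θ p.val)⁻¹) = plusProd θ p.toList := by
      rw [← plus_mul_plusProd_comm, plus_mul_plusProd_of_mem θ (mem_toList.2 p.val_mem)]
    -- The idempotent `e = (st)^⊕` is dropped from the translate `eA`, because `θ e` fixes `θ (st)`.
    rw [h1, mul_val, mul_assoc, h.plusProd_map_idem_mul he _ (h.map_plus_mul _), ← mul_assoc,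
      ← plusProd_comm]
    calc plusProd θ p.toList * plusProd θ (q.toList.map (p.val * ·)) * θ (p.val * q.val)
        = plusProd θ (q.toList.map (p.val * ·)) *
            (plusProd θ p.toList * (θ p.val * (θ p.val)⁻¹)) * θ (p.val * q.val) := by
          rw [hs, plusProd_comm]
      _ = plusProd θ p.toList * plusProd θ (q.toList.map (p.val * ·)) *
            (θ p.val * θ q.val) := by
          rw [h.left, plusProd_comm θ p.toList]; simp only [mul_assoc]
      _ = plusProd θ p.toList * (θ p.val * plusProd θ q.toList) * θ q.val := by
          rw [h.mul_plusProd]; simp only [mul_assoc]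
      _ = _ := by simp only [mul_assoc]

theorem lift_apply {T : Type v} [InverseMonoid T] {θ : S → T} (h : IsStrongPremorphism θ)
    (p : PrefixExpansion S) : lift h p = plusProd θ p.toList * θ p.val := rfl

theorem lift_of {T : Type v} [InverseMonoid T] {θ : S → T} (h : IsStrongPremorphism θ) (s : S) :
    lift h (of s) = θ s := by
  have h1 : plusProd θ (of s).toList = plusProd θ [s * s⁻¹, s] :=
    plusProd_congr θ fun x => by rw [mem_toList, of_carrier]; simp
  rw [lift_apply, h1, of_val, plusProd_cons, plusProd_cons, plusProd_nil, mul_one,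
    plus_eq_self_of_idem (h.map_idem (plus_idem s)), mul_assoc, mul_inv_mul, h.map_plus_mul]

/-- Of the four products two coincide, as `(st)^⊕ s = s t^⊕`. The right-hand sides of both strong
laws reduce to this same set. -/
theorem mul_of_carrier (s t : S) :
    (of s * of t).carrier = {s * t * (s * t)⁻¹, s * (t * t⁻¹), s * t} := by
  rw [mul_carrier, of_carrier, of_carrier, of_val, of_val, Set.image_pair, Set.image_pair,
    plus_mul_plus, plus_mul_self]
  ext x
  simp only [Set.mem_union, Set.mem_insert_iff, Set.mem_singleton_iff]
  tauto

theorem isStrongPremorphism_of : IsStrongPremorphism (of : S → PrefixExpansion S) where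
  map_one := by
    ext1
    · rw [of_carrier, one_carrier, one_inv, one_mul, Set.pair_eq_singleton]
    · rfl
  right s t := by
    have hv : s * t * (t⁻¹ * t) = s * t := by
      rw [mul_assoc, ← mul_assoc t, mul_inv_mul]
    ext1
    · rw [mul_of_carrier, mul_carrier, mul_carrier, inv_carrier, mul_val, inv_val]
      simp only [of_val, of_carrier, Set.image_pair, Set.image_union, hv]
      have h1 : s * t * (s * t)⁻¹ * (s * t * (s * t)⁻¹) = s * t * (s * t)⁻¹ := plus_idem _
      have h2 : t⁻¹ * t * (t⁻¹ * t)⁻¹ = t⁻¹ * t := by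
        rw [mul_inv_rev, inv_inv]
        simpa using plus_idem t⁻¹
      have h3 : s * t * t⁻¹ = s * (t * t⁻¹) := mul_assoc _ _ _
      have h4 : t⁻¹ * (t * t⁻¹) = t⁻¹ := by
        simpa [mul_assoc] using mul_inv_mul t⁻¹
      have h5 : t⁻¹ * t * t⁻¹ = t⁻¹ := by rw [mul_assoc, h4]
      have h6 : t⁻¹ * t * (t⁻¹ * t) = t⁻¹ * t := by rw [← mul_assoc, h5]
      simp only [h1, h2, h4, h5, h6, h3, hv, mul_inv_mul]
      ext x
      simp only [Set.mem_union, Set.mem_insert_iff, Set.mem_singleton_iff]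
      tauto
    · exact hv.symm
  left s t := by
    have hv : s * s⁻¹ * (s * t) = s * t := by rw [← mul_assoc, mul_inv_mul]
    ext1
    · rw [mul_of_carrier, mul_carrier, mul_inv_self_carrier, mul_inv_self_val]
      simp only [of_val, of_carrier, Set.image_pair, hv, plus_mul_plus, plus_mul_self]
      have h1 : s * s⁻¹ * (s * t * (s * t)⁻¹) = s * t * (s * t)⁻¹ := by
        rw [← mul_assoc, hv]
      rw [h1]
      ext x
      simp only [Set.mem_union, Set.mem_insert_iff, Set.mem_singleton_iff]
      tauto
    · exact hv.symm

/-- For `a` in the `𝓡`-class of `s`, `(of a)^⊕ = ({s s⁻¹, a}, s s⁻¹)`. Multiplying by it on the left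
fixes the second component `s` and adjoins `a` to the first. -/
theorem plusProd_of_mul_of (l : List S) (s : S) (hl : ∀ a ∈ l, a * a⁻¹ = s * s⁻¹) :
    (plusProd of l * of s).val = s ∧
      (plusProd of l * of s).carrier = {a | a ∈ l} ∪ {s * s⁻¹, s} := by
  induction l with
  | nil => simp [plusProd_nil, of_val, of_carrier]
  | cons a l ih =>
    obtain ⟨ih1, ih2⟩ := ih fun b hb => hl b (List.mem_cons_of_mem _ hb)
    have ha := hl a List.mem_cons_self
    have hv : a * a⁻¹ * s = s := by rw [ha, mul_inv_mul]
    have hl' : ∀ x ∈ ({a | a ∈ l} ∪ {s * s⁻¹, s} : Set S), s * s⁻¹ * x = x := by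
      rintro x (hx | rfl | rfl)
      · rw [← hl x (List.mem_cons_of_mem _ hx), mul_inv_mul]
      · exact plus_idem s
      · exact mul_inv_mul x
    have haa : s * s⁻¹ * a = a := by rw [← ha, mul_inv_mul]
    rw [plusProd_cons, mul_assoc]
    refine ⟨by rw [mul_val, mul_inv_self_val, of_val, ih1, hv], ?_⟩
    rw [mul_carrier, mul_inv_self_carrier, mul_inv_self_val, of_val, of_carrier, ih1, ih2, hv,
      ha, Set.image_pair, plus_idem, haa, Set.image_congr hl', Set.image_id']
    ext x
    simp only [Set.mem_union, Set.mem_insert_iff, Set.mem_singleton_iff, Set.mem_ofPred_eq,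
      List.mem_cons]
    tauto

theorem lift_isStrongPremorphism_of (p : PrefixExpansion S) :
    lift isStrongPremorphism_of p = p := by
  obtain ⟨h1, h2⟩ := plusProd_of_mul_of p.toList p.val fun a ha => p.rclass a (mem_toList.1 ha)
  rw [lift_apply]
  ext1
  · rw [h2]
    simp only [mem_toList, Set.ofPred_mem_eq]
    exact Set.union_eq_self_of_subset_right
      (Set.insert_subset p.plus_mem (Set.singleton_subset_iff.2 p.val_mem))
  · exact h1

/-- Naturality of the explicit formula; it identifies the composite `S^pr → FI_s(S) → S^pr` with the
lift of `of`. -/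
theorem map_lift {T : Type v} {U : Type*} [InverseMonoid T] [InverseMonoid U] {θ : S → T}
    {η : S → U} (h : IsStrongPremorphism θ) (h' : IsStrongPremorphism η) (f : T →* U)
    (hf : ∀ s, f (θ s) = η s) (p : PrefixExpansion S) : f (lift h p) = lift h' p := by
  have hl : ∀ l, f (plusProd θ l) = plusProd η l := by
    intro l
    induction l with
    | nil => exact map_one f
    | cons a l ih =>
      rw [plusProd_cons, plusProd_cons, map_mul, map_mul, map_inv_of_mul, hf, ih]
  rw [lift_apply, lift_apply, map_mul, hl, hf]

end PrefixExpansion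

/-! ### Homomorphisms out of free and presented inverse monoids. -/

namespace Free

variable {X : Type u}

theorem hom_ext {T : Type v} [InverseMonoid T] {f g : Free X →* T}
    (h : ∀ x, f (of x) = g (of x)) (w : Free X) : f w = g w := by
  obtain ⟨w⟩ := w
  let q : Word X →* Free X :=
    { toFun := Quotient.mk _, map_one' := rfl, map_mul' := fun _ _ => rfl }
  have hq : f.comp q = g.comp q := by
    refine FreeMonoid.hom_eq ?_
    rintro ⟨x, b⟩
    -- The value `false` is an inverse letter, whose image is forced by preservation of inverses.
    cases b
    · change f (of x)⁻¹ = g (of x)⁻¹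
      rw [map_inv_of_mul, map_inv_of_mul, h]
    · exact h x
  exact DFunLike.congr_fun hq w

end Free

namespace Presented

variable {X : Type u} {r : Free X → Free X → Prop}

/-- The canonical homomorphism from the free inverse monoid. -/
def mkHom (r : Free X → Free X → Prop) : Free X →* Presented r where
  toFun := Quotient.mk _
  map_one' := rfl
  map_mul' _ _ := rfl

theorem mkHom_surjective : Function.Surjective (mkHom r) := Quotient.mk_surjective

theorem mkHom_eq_iff {x y : Free X} : mkHom r x = mkHom r y ↔ InvCongr r x y :=
  Quotient.eq (r := invSetoid r)

theorem mkHom_of (x : X) : mkHom r (Free.of x) = of x := rfl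

/-- The homomorphism extending a map of the generators that satisfies the relations. -/
def lift {T : Type v} [InverseMonoid T] (f : X → T)
    (hf : ∀ x y, r x y → Free.lift f x = Free.lift f y) : Presented r →* T where
  toFun := Quotient.lift (Free.lift f) fun _ _ h =>
    InvCongr.map_eq (Free.lift f) (map_mul _) (Free.lift_inv f) hf h
  map_one' := map_one (Free.lift f)
  map_mul' := by rintro ⟨a⟩ ⟨b⟩; exact map_mul (Free.lift f) a b

theorem lift_mkHom {T : Type v} [InverseMonoid T] (f : X → T)
    (hf : ∀ x y, r x y → Free.lift f x = Free.lift f y) (w : Free X) :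
    lift f hf (mkHom r w) = Free.lift f w := rfl

end Presented

/-! ### The isomorphism and the presentation. -/

theorem IsStrongPremorphism.lift_eq {S : Type u} {T : Type v} [InverseMonoid S] [InverseMonoid T]
    {θ : S → T} (h : IsStrongPremorphism θ) :
    ∀ x y, StrongRel S x y → Free.lift θ x = Free.lift θ y := by
  rintro _ _ (_ | ⟨s, t⟩ | ⟨s, t⟩)
  · rw [Free.lift_of, _root_.map_one, h.map_one]
  · simp only [star, map_mul, Free.lift_inv, Free.lift_of]
    exact h.right s t
  · simp only [plus, map_mul, Free.lift_inv, Free.lift_of]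
    exact h.left s t

theorem FIs.isStrongPremorphism_of {S : Type u} [InverseMonoid S] :
    IsStrongPremorphism (Presented.of : S → FIs S) where
  map_one := Presented.mkHom_eq_iff.2 (InvCongr.of StrongRel.one)
  right s t := Presented.mkHom_eq_iff.2 (InvCongr.of (StrongRel.right s t))
  left s t := Presented.mkHom_eq_iff.2 (InvCongr.of (StrongRel.left s t))

/-- The isomorphism between `S^pr` and `FI_s(S)`. -/
noncomputable def prefixExpansionEquiv (S : Type u) [InverseMonoid S] :
    PrefixExpansion S ≃* FIs S where
  toFun := PrefixExpansion.lift FIs.isStrongPremorphism_of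
  invFun := Presented.lift PrefixExpansion.of PrefixExpansion.isStrongPremorphism_of.lift_eq
  left_inv p := by
    rw [PrefixExpansion.map_lift FIs.isStrongPremorphism_of PrefixExpansion.isStrongPremorphism_of
      _ fun s => (Presented.lift_mkHom _ _ (Free.of s)).trans (Free.lift_of _ s)]
    exact PrefixExpansion.lift_isStrongPremorphism_of p
  right_inv x := by
    obtain ⟨w, rfl⟩ := Presented.mkHom_surjective x
    rw [Presented.lift_mkHom]
    -- Precomposed with the quotient map, the composite `FI_s(S) → S^pr → FI_s(S)` need only be
    -- compared with it on generators.
    refine Free.hom_ext (f := (PrefixExpansion.lift FIs.isStrongPremorphism_of).comp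
      (Free.lift PrefixExpansion.of)) (g := Presented.mkHom (StrongRel S)) (fun s => ?_) w
    rw [MonoidHom.comp_apply, Free.lift_of, PrefixExpansion.lift_of, Presented.mkHom_of]
  map_mul' := map_mul _

theorem prefixExpansionEquiv_of {S : Type u} [InverseMonoid S] (s : S) :
    prefixExpansionEquiv S (PrefixExpansion.of s) = Presented.of s :=
  PrefixExpansion.lift_of FIs.isStrongPremorphism_of s

/-- The canonical map onto `S^pr` is thus the quotient map followed by a bijection, so it inherits
surjectivity and kernel from the quotient map. -/
theorem prefixExpansionEquiv_symm_mkHom {S : Type u} [InverseMonoid S] (w : Free S) :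
    (prefixExpansionEquiv S).symm (Presented.mkHom _ w) = Free.lift PrefixExpansion.of w :=
  rfl

theorem isPresentedBy_prefixExpansion_of (S : Type u) [InverseMonoid S] :
    IsPresentedBy (PrefixExpansion.of (S := S)) (StrongRel S) := by
  refine ⟨fun p => ?_, fun x y => ?_⟩
  · obtain ⟨w, hw⟩ := Presented.mkHom_surjective (prefixExpansionEquiv S p)
    exact ⟨w, by rw [← prefixExpansionEquiv_symm_mkHom, hw, MulEquiv.symm_apply_apply]⟩
  · rw [← prefixExpansionEquiv_symm_mkHom, ← prefixExpansionEquiv_symm_mkHom,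
      EmbeddingLike.apply_eq_iff_eq, Presented.mkHom_eq_iff]

end InverseMonoid

theorem mainTheorem6 (S : Type u) [InverseMonoid S] :
    (∃ e : InverseMonoid.PrefixExpansion S ≃* InverseMonoid.FIs S,
      (∀ p : InverseMonoid.PrefixExpansion S, e p⁻¹ = (e p)⁻¹) ∧
      ∀ s : S, e (InverseMonoid.PrefixExpansion.of s) = InverseMonoid.Presented.of s) ∧
    InverseMonoid.IsPresentedBy (InverseMonoid.PrefixExpansion.of (S := S))
      (InverseMonoid.StrongRel S) :=
  ⟨⟨InverseMonoid.prefixExpansionEquiv S,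
    fun p => InverseMonoid.map_inv_of_mul (InverseMonoid.prefixExpansionEquiv S).toMonoidHom p,
    InverseMonoid.prefixExpansionEquiv_of⟩,
    InverseMonoid.isPresentedBy_prefixExpansion_of S⟩
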